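/- Conventions. A group is \emph{virtually cyclic} if it has a cyclic subgroup of finite index. A virtually cyclic group $V$ is \emph{of type~I} if it admits an epimorphism onto the infinite cyclic group $\mathbb{Z}$. For an infinite virtually cyclic group $V$ of type~I let $K_V$ be its unique maximal finite normal subgroup and put $Q_V := V/K_V$, which is infinite cyclic; a homomorphism $f\colon V\to W$ of such groups maps $K_V$ into $K_W$ and so induces $Q_f\colon Q_V\to Q_W$. The infinite virtually cyclic subgroups of type~I of a group $G$ are \emph{orientable} if one can choose, for every infinite virtually cyclic subgroup $V\subseteq G$ of type~I, a generator $\sigma_V$ of $Q_V$ such that, whenever $V,W\subseteq G$ are infinite virtually cyclic subgroups of type~I and $f\colon V\to W$ is an inclusion or is given by conjugation by an element of $G$, one has $Q_f(\sigma_V)=\sigma_W^{\,n}$ for some integer $n\ge 1$. A \emph{CAT(0)-group} is a group that acts properly, cocompactly and by isometries on some non-empty CAT(0)-space, i.e. a geodesic metric space whose geodesic triangles satisfy the CAT(0) comparison inequality; here an action on $X$ is proper if every $x\in X$ has a ball $B=B(x,r)$, $r>0$, such that $gB\cap B\neq\emptyset$ for only finitely many group elements $g$, and cocompact if the translates of some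 compact subset cover $X$. \textbf{Lemma.} Let $G$ be a CAT(0)-group. Then the infinite virtually cyclic subgroups of type~I of $G$ are orientable if and only if all infinite virtually cyclic subgroups of $G$ are of type~I and no subgroup of $G$ is isomorphic to the fundamental group $\mathbb{Z}\rtimes\mathbb{Z}$ of the Klein bottle, in which a generator of the right-hand factor acts on the left-hand factor by $n\mapsto -n$. -/

import Mathlib

universe u v

namespace CatZeroOrient

/-! ### CAT(0)-groups -/

/-- `c`, restricted to `[0, d(x, y)]`, is a geodesic path from `x` to `y`. -/
structure IsGeodesic {X : Type v} [MetricSpace X] (c : ℝ → X) (x y : X) : Prop where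
  source : c 0 = x
  target : c (dist x y) = y
  isometric : ∀ s ∈ Set.Icc 0 (dist x y), ∀ t ∈ Set.Icc 0 (dist x y), dist (c s) (c t) = |s - t|

/-- A CAT(0)-space: a geodesic metric space all of whose geodesic triangles are at least as thin
as their comparison triangles in the Euclidean plane. Two distinct sides of a triangle share a
vertex, here called `p`; for two points on the same side the comparison is an equality. -/
structure IsCATZeroSpace (X : Type v) [MetricSpace X] : Prop where
  exists_geodesic : ∀ x y : X, ∃ c : ℝ → X, IsGeodesic c x y
  comparison : ∀ (p q r : X) (c₁ c₂ : ℝ → X), IsGeodesic c₁ p q → IsGeodesic c₂ p r →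
    ∀ p' q' r' : EuclideanSpace ℝ (Fin 2),
      dist p' q' = dist p q → dist p' r' = dist p r → dist q' r' = dist q r →
    ∀ s ∈ Set.Icc 0 (dist p q), ∀ t ∈ Set.Icc 0 (dist p r),
    ∀ x' ∈ segment ℝ p' q', ∀ y' ∈ segment ℝ p' r', dist p' x' = s → dist p' y' = t →
      dist (c₁ s) (c₂ t) ≤ dist x' y'

/-- A proper action on a metric space: every point has a ball that meets only finitely many of its
translates. -/
def IsProperAction (G : Type u) [Group G] (X : Type v) [MetricSpace X] [MulAction G X] : Prop :=
  ∀ x : X, ∃ r > 0,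
    {g : G | (((fun y : X => g • y) '' Metric.ball x r) ∩ Metric.ball x r).Nonempty}.Finite

/-- A cocompact action: the translates of some compact subset cover the space. -/
def IsCocompactAction (G : Type u) [Group G] (X : Type v) [MetricSpace X] [MulAction G X] : Prop :=
  ∃ K : Set X, IsCompact K ∧ ∀ x : X, ∃ g : G, ∃ y ∈ K, g • y = x

/-- A CAT(0)-group: a group that acts properly, cocompactly and by isometries on a non-empty
CAT(0)-space. -/
def IsCATZeroGroup (G : Type u) [Group G] : Prop :=
  ∃ (X : Type v) (_ : MetricSpace X) (_ : MulAction G X),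
    Nonempty X ∧ IsCATZeroSpace X ∧ IsIsometricSMul G X ∧
      IsProperAction G X ∧ IsCocompactAction G X

/-! ### Virtually cyclic groups -/

/-- A group with a cyclic subgroup of finite index. -/
def IsVirtuallyCyclic (V : Type u) [Group V] : Prop :=
  ∃ C : Subgroup V, IsCyclic C ∧ C.FiniteIndex

/-- There is an epimorphism onto the infinite cyclic group. -/
def IsTypeI (V : Type u) [Group V] : Prop :=
  ∃ f : V →* Multiplicative ℤ, Function.Surjective f

/-- `V` is an infinite virtually cyclic group of type I. -/
structure IsInfVCycTypeI (V : Type u) [Group V] : Prop where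
  infinite : Infinite V
  virtuallyCyclic : IsVirtuallyCyclic V
  typeI : IsTypeI V

/-- `K_V`: the subgroup generated by all finite normal subgroups. For an infinite virtually cyclic
group of type I it is itself finite and normal, see `isGreatest_finiteRadical`; so it is the unique
maximal finite normal subgroup. -/
def finiteRadical (V : Type u) [Group V] : Subgroup V :=
  sSup {N : Subgroup V | N.Normal ∧ Finite N}

instance finiteRadical_normal (V : Type u) [Group V] : (finiteRadical V).Normal := by
  rw [finiteRadical, sSup_eq_iSup']
  have : ∀ N : {N : Subgroup V | N.Normal ∧ Finite N}, (N : Subgroup V).Normal :=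
    fun N => N.2.1
  exact Subgroup.iSup_normal _

/-- `Q_V = V / K_V`. -/
abbrev radQuotient (V : Type u) [Group V] : Type u := V ⧸ finiteRadical V

theorem finiteRadical_le_ker {V : Type u} [Group V] (f : V →* Multiplicative ℤ) :
    finiteRadical V ≤ f.ker := by
  refine sSup_le ?_
  rintro N ⟨-, hN⟩ x hx
  have h1 : IsOfFinOrder (⟨x, hx⟩ : N) := isOfFinOrder_of_finite _
  have h2 : IsOfFinOrder x := (N.subtype).isOfFinOrder h1
  have h3 : IsOfFinOrder (f x) := f.isOfFinOrder h2
  exact MonoidHom.mem_ker.2 ((isOfFinOrder_iff_eq_one _).1 h3)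

theorem finite_ker {V : Type u} [Group V] (hV : IsVirtuallyCyclic V)
    (f : V →* Multiplicative ℤ) (hf : Function.Surjective f) : Finite f.ker := by
  obtain ⟨C, hC, hfin⟩ := hV
  obtain ⟨c, hc⟩ := (Subgroup.isCyclic_iff_exists_zpowers_eq_top C).1 hC
  have hfc : f c ≠ 1 := by
    intro h
    have hle : C ≤ f.ker := by
      rw [← hc, Subgroup.zpowers_le]
      exact MonoidHom.mem_ker.2 h
    have hk : f.ker.FiniteIndex := Subgroup.finiteIndex_of_le hle
    have h1 : Finite (V ⧸ f.ker) := Subgroup.finite_quotient_of_finiteIndex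
    have h2 : Finite (Multiplicative ℤ) :=
      Finite.of_equiv _ (QuotientGroup.quotientKerEquivOfSurjective f hf).toEquiv
    exact not_finite (Multiplicative ℤ)
  have hinf : ¬ IsOfFinOrder (f c) := fun h => hfc (isOfFinOrder_iff_eq_one _ |>.1 h)
  have h1 : Finite (V ⧸ C) := Subgroup.finite_quotient_of_finiteIndex
  refine Finite.of_injective (fun x : f.ker => (QuotientGroup.mk (x : V) : V ⧸ C)) ?_
  rintro ⟨x, hx⟩ ⟨y, hy⟩ hxy
  have hxy' : x⁻¹ * y ∈ C := QuotientGroup.eq.1 hxy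
  rw [← hc] at hxy'
  obtain ⟨n, hn⟩ := Subgroup.mem_zpowers_iff.1 hxy'
  have h2 : f c ^ n = 1 := by
    rw [← map_zpow, hn, map_mul, map_inv, MonoidHom.mem_ker.1 hx, MonoidHom.mem_ker.1 hy]
    simp
  have h3 : n = 0 := by
    by_contra hne
    exact hinf (isOfFinOrder_iff_zpow_eq_one.2 ⟨n, hne, h2⟩)
  rw [h3, zpow_zero] at hn
  exact Subtype.ext (inv_mul_eq_one.1 hn.symm)

theorem isGreatest_finiteRadical {V : Type u} [Group V] (hV : IsInfVCycTypeI V) :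
    IsGreatest {N : Subgroup V | N.Normal ∧ Finite N} (finiteRadical V) := by
  obtain ⟨f, hf⟩ := hV.typeI
  have := finite_ker hV.virtuallyCyclic f hf
  exact ⟨⟨inferInstance, Finite.of_injective _
    (Subgroup.inclusion_injective (finiteRadical_le_ker f))⟩, fun N hN => le_sSup hN⟩

theorem finiteRadical_le_comap {V W : Type u} [Group V] [Group W] (hW : IsInfVCycTypeI W)
    (φ : V →* W) : finiteRadical V ≤ (finiteRadical W).comap φ := by
  obtain ⟨f, hf⟩ := hW.typeI
  have h : f.ker ≤ finiteRadical W :=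
    le_sSup ⟨inferInstance, finite_ker hW.virtuallyCyclic f hf⟩
  exact fun x hx => h (finiteRadical_le_ker (f.comp φ) hx)

/-- The homomorphism `Q_φ : Q_V → Q_W` induced by a homomorphism `φ : V → W`. -/
def radMap {V W : Type u} [Group V] [Group W] (hW : IsInfVCycTypeI W) (φ : V →* W) :
    radQuotient V →* radQuotient W :=
  QuotientGroup.map (finiteRadical V) (finiteRadical W) φ (finiteRadical_le_comap hW φ)

/-! ### Orientations -/

/-- An orientation: a choice of a generator `σ V` of `Q_V` for every infinite virtually cyclic
subgroup `V` of type I such that, for every `f : V → W` that is an inclusion or conjugation by an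
element of `G`, the map `Q_f` sends `σ V` to a positive multiple of `σ W`. -/
structure IsOrientation (G : Type u) [Group G]
    (σ : ∀ V : {V : Subgroup G // IsInfVCycTypeI V}, radQuotient V.1) : Prop where
  generator : ∀ V, Subgroup.zpowers (σ V) = ⊤
  compatible : ∀ (V W : {V : Subgroup G // IsInfVCycTypeI V}) (f : V.1 →* W.1),
    ((∀ x : V.1, (f x : G) = x) ∨ ∃ g : G, ∀ x : V.1, (f x : G) = g * x * g⁻¹) →
      ∃ n : ℕ, 0 < n ∧ radMap W.2 f (σ V) = σ W ^ n

/-- The infinite virtually cyclic subgroups of type I of `G` are orientable. -/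
def TypeIOrientable (G : Type u) [Group G] : Prop :=
  ∃ σ : ∀ V : {V : Subgroup G // IsInfVCycTypeI V}, radQuotient V.1, IsOrientation G σ

/-! ### The Klein bottle group -/

/-- The fundamental group `ℤ ⋊ ℤ` of the Klein bottle; the generator of the right factor acts on the
left one by inversion. -/
abbrev KleinBottleGroup : Type :=
  Multiplicative ℤ ⋊[zpowersHom (MulAut (Multiplicative ℤ)) (MulEquiv.inv (Multiplicative ℤ))]
    Multiplicative ℤ

end CatZeroOrient

/-! Both sides of the equivalence say that no element `c` of infinite order is conjugate to its
inverse.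

If `g * c * g⁻¹ = c⁻¹`, conjugation by `g` reverses every generator of `⟨c⟩`, so no orientation
exists (`TypeIOrientable.conj_ne_inv`). Such a pair occurs in the Klein bottle group and in every
infinite virtually cyclic group not of type I. Conversely, such a pair defines a homomorphism from
the Klein bottle group; either it is injective, or its image is infinite virtually cyclic and not of
type I (`conj_ne_inv_of_isTypeI`).

To build an orientation, signs must be chosen consistently on classes of elements with conjugate
powers. The obstruction is a relation `g * a ^ m * g⁻¹ = a ^ (-n)` with `m, n > 0`. Only here does
CAT(0) geometry enter: translation length is conjugation invariant, multiplicative on powers and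
positive on elements of infinite order, so `m = n` and `a ^ m` is conjugate to its inverse. -/

namespace CatZeroOrient

/-! ### Translation lengths -/

section Displacement

variable {G : Type u} [Group G] {X : Type v} [MetricSpace X] [MulAction G X]

/-- Euclidean isosceles triangles with legs `d` and base `e ≤ 2 d`. -/
theorem exists_isosceles_triangle {d e : ℝ} (he : 0 ≤ e) (hed : e ≤ 2 * d) :
    ∃ p q r : EuclideanSpace ℝ (Fin 2), dist p q = d ∧ dist p r = d ∧ dist q r = e := by
  have hd : 0 ≤ d := by linarith
  have hs : Real.sqrt (d ^ 2 - (e / 2) ^ 2) ^ 2 = d ^ 2 - (e / 2) ^ 2 :=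
    Real.sq_sqrt (by nlinarith)
  refine ⟨!₂[0, Real.sqrt (d ^ 2 - (e / 2) ^ 2)], !₂[-(e / 2), 0], !₂[e / 2, 0], ?_, ?_, ?_⟩
  all_goals
    rw [EuclideanSpace.dist_eq, Real.sqrt_eq_iff_mul_self_eq (by positivity) (by assumption)]
    simp only [Fin.sum_univ_two, Real.dist_eq, sq_abs]
    simp
    nlinarith

/-- Take `y` to be the midpoint of a geodesic from `g • x` to `x`. The reversed `g`-translate of
that geodesic starts at the same vertex and has midpoint `g • y`, so CAT(0) comparison bounds the
distance of the midpoints by half the third side. -/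
theorem exists_two_mul_dist_smul_le [IsIsometricSMul G X] (hX : IsCATZeroSpace X) (g : G) (x : X) :
    ∃ y : X, 2 * dist y (g • y) ≤ dist x ((g * g) • x) := by
  obtain ⟨c, hc⟩ := hX.exists_geodesic (g • x) x
  set d := dist (g • x) x with hd
  have hd0 : 0 ≤ d := dist_nonneg
  have hd' : dist (g • x) ((g * g) • x) = d := by
    rw [mul_smul, dist_smul, dist_comm]
  have hc' : IsGeodesic (fun t => g • c (d - t)) (g • x) ((g * g) • x) := by
    refine ⟨by simp [hc.target, hd], by rw [hd']; simp [hc.source, mul_smul], ?_⟩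
    rw [hd']
    intro s hs t ht
    rw [dist_smul, hc.isometric _ ⟨by linarith [hs.2], by linarith [hs.1]⟩ _
      ⟨by linarith [ht.2], by linarith [ht.1]⟩, abs_sub_comm]
    congr 1
    ring
  have he : dist x ((g * g) • x) ≤ 2 * d := by
    have := dist_triangle x (g • x) ((g * g) • x)
    rw [hd', dist_comm x (g • x)] at this
    linarith
  obtain ⟨p, q, r, hpq, hpr, hqr⟩ := exists_isosceles_triangle dist_nonneg he
  have hmid := hX.comparison (g • x) x ((g * g) • x) c _ hc hc' p q r hpq (hpr.trans hd'.symm) hqr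
    (d / 2) ⟨by positivity, by linarith⟩ (d / 2) ⟨by positivity, by rw [hd']; linarith⟩
    (midpoint ℝ p q) (midpoint_mem_segment p q) (midpoint ℝ p r) (midpoint_mem_segment p r)
    (by rw [dist_left_midpoint, hpq]; norm_num; ring)
    (by rw [dist_left_midpoint, hpr]; norm_num; ring)
  have h2 : dist (midpoint ℝ p q) (midpoint ℝ p r) = dist x ((g * g) • x) / 2 := by
    rw [← hqr, dist_eq_norm, dist_eq_norm, midpoint_eq_smul_add, midpoint_eq_smul_add, ← smul_sub,
      norm_smul, add_sub_add_left_eq_sub]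
    norm_num
    ring
  rw [h2] at hmid
  refine ⟨c (d / 2), ?_⟩
  have h3 : d - d / 2 = d / 2 := by ring
  simp only [h3] at hmid
  linarith

theorem dist_pow_smul_le [IsIsometricSMul G X] (g : G) (x : X) (n : ℕ) :
    dist x (g ^ n • x) ≤ n * dist x (g • x) := by
  induction n with
  | zero => simp
  | succ n ih =>
    have h := dist_triangle x (g ^ n • x) (g ^ (n + 1) • x)
    rw [pow_succ, mul_smul, dist_smul, ← mul_smul, ← pow_succ] at h
    push_cast
    linarith

theorem two_pow_mul_le_dist_smul [IsIsometricSMul G X] (hX : IsCATZeroSpace X) {g : G} {L : ℝ}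
    (hL : ∀ x : X, L ≤ dist x (g • x)) (k : ℕ) (x : X) :
    2 ^ k * L ≤ dist x (g ^ 2 ^ k • x) := by
  induction k generalizing x with
  | zero => simpa using hL x
  | succ k ih =>
    obtain ⟨y, hy⟩ := exists_two_mul_dist_smul_le hX (g ^ 2 ^ k) x
    rw [← pow_add, ← two_mul, ← pow_succ'] at hy
    have := ih y
    rw [pow_succ]
    linarith

/-- A deficit at the exponent `j` would grow linearly along multiples of `j` and eventually violate
the bound already known at powers of two. -/
theorem nat_mul_le_dist_smul [IsIsometricSMul G X] (hX : IsCATZeroSpace X) {g : G} {L : ℝ}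
    (hL : ∀ x : X, L ≤ dist x (g • x)) (j : ℕ) (x : X) :
    j * L ≤ dist x (g ^ j • x) := by
  rcases Nat.eq_zero_or_pos j with rfl | hj
  · simp
  by_contra! hlt
  -- With `2 ^ (j * N) = j * l + r`, the deficit accumulates `l ≥ N` times, while the remainder
  -- contributes at most `j * (dist x (g • x) - L)`.
  obtain ⟨N, hN⟩ := exists_nat_gt ((j * dist x (g • x) - j * L) / (j * L - dist x (g ^ j • x)))
  rw [div_lt_iff₀ (by linarith)] at hN
  set l := 2 ^ (j * N) / j
  set r := 2 ^ (j * N) % j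
  have hlr : j * l + r = 2 ^ (j * N) := Nat.div_add_mod _ _
  have hNl : (N : ℝ) ≤ l := by
    exact_mod_cast (Nat.le_div_iff_mul_le hj).2 (by rw [mul_comm]; exact Nat.lt_two_pow_self.le)
  have hr : (r : ℝ) ≤ j := by exact_mod_cast (Nat.mod_lt _ hj).le
  have h1 := two_pow_mul_le_dist_smul hX hL (j * N) x
  have h2 : dist x (g ^ 2 ^ (j * N) • x) ≤ l * dist x (g ^ j • x) + r * dist x (g • x) := by
    have h3 := dist_triangle x ((g ^ j) ^ l • x) (g ^ 2 ^ (j * N) • x)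
    rw [← hlr, pow_add, pow_mul, mul_smul, dist_smul] at h3
    rw [← hlr, pow_add, pow_mul, mul_smul]
    linarith [dist_pow_smul_le (g ^ j) x l, dist_pow_smul_le g x r]
  have h4 : (2 : ℝ) ^ (j * N) = j * l + r := by exact_mod_cast hlr.symm
  rw [h4] at h1
  have h5 := mul_le_mul_of_nonneg_right hNl (sub_nonneg.2 hlt.le)
  have h6 := mul_le_mul_of_nonneg_right hr (sub_nonneg.2 (hL x))
  linarith

variable (X) in
/-- The infimum of the distances by which `g` moves the points of `X`. -/
noncomputable def translationLength (g : G) : ℝ := ⨅ x : X, dist x (g • x)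

theorem translationLength_le (g : G) (x : X) : translationLength X g ≤ dist x (g • x) :=
  ciInf_le ⟨0, by rintro _ ⟨y, rfl⟩; exact dist_nonneg⟩ x

theorem translationLength_inv [IsIsometricSMul G X] (g : G) :
    translationLength X g⁻¹ = translationLength X g := by
  refine iInf_congr fun x => ?_
  rw [← dist_smul g x, smul_inv_smul, dist_comm]

theorem translationLength_conj [IsIsometricSMul G X] (g h : G) :
    translationLength X (g * h * g⁻¹) = translationLength X h := by
  refine (Equiv.iInf_congr (MulAction.toPerm g) fun x => ?_).symm
  simp [mul_smul]

theorem translationLength_pow [IsIsometricSMul G X] [Nonempty X] (hX : IsCATZeroSpace X) (g : G)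
    (n : ℕ) : translationLength X (g ^ n) = n * translationLength X g := by
  refine le_antisymm ?_ (le_ciInf (nat_mul_le_dist_smul hX (translationLength_le g) n))
  rw [translationLength, translationLength, Real.mul_iInf_of_nonneg n.cast_nonneg]
  exact ciInf_mono ⟨0, by rintro _ ⟨y, rfl⟩; exact dist_nonneg⟩ (dist_pow_smul_le g · n)

theorem translationLength_zpow [IsIsometricSMul G X] [Nonempty X] (hX : IsCATZeroSpace X) (g : G)
    (n : ℤ) : translationLength X (g ^ n) = |n| * translationLength X g := by
  obtain ⟨k, rfl | rfl⟩ := n.eq_nat_or_neg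
  · simp [translationLength_pow hX]
  · simp [translationLength_pow hX, translationLength_inv]

/-- If the infimum were zero, cocompactness would give conjugates of `g` moving points of `K`
arbitrarily little. Near a limit point `z`, properness leaves finitely many such conjugates, so one
recurs and fixes `z`; point stabilizers are finite, so `g` has finite order. -/
theorem translationLength_pos [IsIsometricSMul G X] [Nonempty X] (hP : IsProperAction G X)
    (hC : IsCocompactAction G X) {g : G} (hg : ¬ IsOfFinOrder g) : 0 < translationLength X g := by
  by_contra! h
  obtain ⟨K, hK, hcov⟩ := hC
  have h1 : ∀ n : ℕ, ∃ y ∈ K, ∃ k : G, dist y ((k * g * k⁻¹) • y) < 1 / (n + 1 : ℝ) := by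
    intro n
    obtain ⟨x, hx⟩ := exists_lt_of_ciInf_lt (h.trans_lt (Nat.one_div_pos_of_nat (α := ℝ) (n := n)))
    obtain ⟨k, y, hy, rfl⟩ := hcov x
    refine ⟨y, hy, k⁻¹, ?_⟩
    rw [← dist_smul k]
    simpa [mul_smul] using hx
  choose y hyK k hk using h1
  obtain ⟨z, -, φ, hφ, hz⟩ := hK.tendsto_subseq hyK
  obtain ⟨r, hr, hfin⟩ := hP z
  set a : ℕ → G := fun n => k n * g * (k n)⁻¹ with ha
  have h0 : Filter.Tendsto (fun n => dist (y (φ n)) z) Filter.atTop (nhds 0) :=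
    tendsto_iff_dist_tendsto_zero.1 hz
  have h2 : Filter.Tendsto (fun n => dist z (a (φ n) • z)) Filter.atTop (nhds 0) := by
    have h3 : Filter.Tendsto (fun n : ℕ => 1 / ((φ n : ℕ) + 1 : ℝ)) Filter.atTop (nhds 0) :=
      tendsto_one_div_add_atTop_nhds_zero_nat.comp hφ.tendsto_atTop
    refine squeeze_zero (fun _ => dist_nonneg) (fun n => ?_)
      (by simpa using (h0.add h3).add h0 : Filter.Tendsto (fun n => dist (y (φ n)) z +
        1 / ((φ n : ℕ) + 1 : ℝ) + dist (y (φ n)) z) Filter.atTop (nhds 0))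
    have h4 := dist_triangle4 z (y (φ n)) (a (φ n) • y (φ n)) (a (φ n) • z)
    rw [dist_smul, dist_comm z (y (φ n))] at h4
    linarith [hk (φ n)]
  have h5 : ∀ᶠ n in Filter.atTop, a (φ n) ∈
      {g : G | (((fun y : X => g • y) '' Metric.ball z r) ∩ Metric.ball z r).Nonempty} := by
    filter_upwards [h2.eventually (gt_mem_nhds hr)] with n hn
    exact ⟨a (φ n) • z, ⟨z, Metric.mem_ball_self hr, rfl⟩, by rwa [Metric.mem_ball, dist_comm]⟩
  obtain ⟨b, hb⟩ : ∃ b, ∃ᶠ n in Filter.atTop, a (φ n) = b := by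
    by_contra hcon
    have h6 := (Filter.eventually_all_finite hfin).2 fun b _ =>
      Filter.not_frequently.1 fun hb => hcon ⟨b, hb⟩
    obtain ⟨n, hn, hn'⟩ := (h5.and h6).exists
    exact hn' _ hn rfl
  have hbz : b • z = z := by
    by_contra hne
    have hpos : 0 < dist z (b • z) := dist_pos.2 (Ne.symm hne)
    obtain ⟨n, hn, hn'⟩ := (hb.and_eventually (h2.eventually (gt_mem_nhds hpos))).exists
    rw [hn] at hn'
    exact lt_irrefl _ hn'
  obtain ⟨n, hn⟩ := hb.exists
  have hbfin : IsOfFinOrder b := by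
    by_contra hinf
    refine Set.infinite_of_injective_forall_mem (injective_pow_iff_not_isOfFinOrder.2 hinf)
      (fun m => ?_) hfin
    have hm : b ^ m • z = z := by
      have : b ^ m ∈ MulAction.stabilizer G z := pow_mem (MulAction.mem_stabilizer_iff.2 hbz) m
      exact this
    exact ⟨z, ⟨z, Metric.mem_ball_self hr, hm⟩, Metric.mem_ball_self hr⟩
  have h7 : g = (k (φ n))⁻¹ * b * ((k (φ n))⁻¹)⁻¹ := by rw [← hn, ha]; group
  have h8 : IsOfFinOrder (MulAut.conj (k (φ n))⁻¹ b) :=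
    (MulAut.conj (k (φ n))⁻¹).toMonoidHom.isOfFinOrder hbfin
  exact hg (by rw [h7]; exact h8)

end Displacement

theorem IsCATZeroGroup.abs_eq_of_conj_zpow_eq {G : Type u} [Group G]
    (hG : IsCATZeroGroup.{u, v} G) {c g : G} (hc : ¬ IsOfFinOrder c) {m n : ℤ}
    (h : g * c ^ m * g⁻¹ = c ^ n) : |m| = |n| := by
  obtain ⟨X, _, _, hne, hX, _, hP, hC⟩ := hG
  have h1 := translationLength_conj (X := X) g (c ^ m)
  rw [h, translationLength_zpow hX, translationLength_zpow hX] at h1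
  exact_mod_cast (mul_right_cancel₀ (translationLength_pos hP hC hc).ne' h1).symm

end CatZeroOrient

namespace CatZeroOrient

/-! ### Virtually cyclic groups -/

section VirtuallyCyclic

variable {V : Type u} [Group V]

theorem isTypeI_of_map_ne_one (F : V →* Multiplicative ℤ) {x : V} (hx : F x ≠ 1) : IsTypeI V := by
  have hinf : Infinite F.range := by
    refine Infinite.of_injective (fun n : ℕ => (⟨F (x ^ n), x ^ n, rfl⟩ : F.range)) ?_
    intro m n hmn
    have h : ¬ IsOfFinOrder (F x) := fun h => hx ((isOfFinOrder_iff_eq_one _).1 h)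
    refine injective_pow_iff_not_isOfFinOrder.2 h ?_
    simpa using congrArg Subtype.val hmn
  exact ⟨(intCyclicMulEquiv (G := F.range)).symm.toMonoidHom.comp F.rangeRestrict,
    (intCyclicMulEquiv (G := F.range)).symm.surjective.comp F.rangeRestrict_surjective⟩

theorem infinite_zpowers_of_not_isOfFinOrder {c : V} (hc : ¬ IsOfFinOrder c) :
    Infinite (Subgroup.zpowers c) :=
  Set.infinite_coe_iff.2 (infinite_zpowers.2 hc)

theorem zpowers_mk_self_eq_top (c : V) :
    Subgroup.zpowers (⟨c, Subgroup.mem_zpowers c⟩ : Subgroup.zpowers c) = ⊤ := by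
  refine (Subgroup.eq_top_iff' _).2 ?_
  rintro ⟨_, k, rfl⟩
  exact ⟨k, Subtype.ext (by simp)⟩

/-- The transfer to a central subgroup of finite index `n` sends `c` to `c ^ n`, which is
nontrivial. -/
theorem isTypeI_of_central {c : V} (hc : ¬ IsOfFinOrder c)
    (hfin : (Subgroup.zpowers c).FiniteIndex) (hcen : ∀ g : V, g * c * g⁻¹ = c) : IsTypeI V := by
  have := infinite_zpowers_of_not_isOfFinOrder hc
  let e := (intEquivOfZPowersEqTop _ (zpowers_mk_self_eq_top c)).symm
  have hcen' : ∀ g : V, Commute g c := fun g => mul_inv_eq_iff_eq_mul.1 (hcen g)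
  have hkey : ∀ (k : ℕ) (g₀ : V), g₀⁻¹ * c ^ k * g₀ ∈ Subgroup.zpowers c →
      g₀⁻¹ * c ^ k * g₀ = c ^ k := by
    intro k g₀ _
    rw [((hcen' g₀⁻¹).pow_right k).eq, inv_mul_cancel_right]
  refine isTypeI_of_map_ne_one (MonoidHom.transfer e.toMonoidHom) (x := c) ?_
  rw [MonoidHom.transfer_eq_pow _ c hkey]
  intro h
  have h1 := (map_eq_one_iff e e.injective).1 h
  have h2 : c ^ (Subgroup.zpowers c).index = 1 := congrArg Subtype.val h1
  exact hc (isOfFinOrder_iff_pow_eq_one.2 ⟨_, Nat.pos_of_ne_zero hfin.index_ne_zero, h2⟩)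

/-- The normal core of a cyclic subgroup of finite index is infinite cyclic, and conjugation acts on
it by `±1`. If only `+1` occurred, the core would be central. -/
theorem exists_conj_eq_inv_of_not_isTypeI [Infinite V] (hV : IsVirtuallyCyclic V)
    (hI : ¬ IsTypeI V) : ∃ c g : V, ¬ IsOfFinOrder c ∧ g * c * g⁻¹ = c⁻¹ := by
  obtain ⟨C, hC, hfin⟩ := hV
  have hcyc : IsCyclic C.normalCore :=
    isCyclic_of_injective _ (Subgroup.inclusion_injective C.normalCore_le)
  obtain ⟨c, hcN⟩ := (Subgroup.isCyclic_iff_exists_zpowers_eq_top _).1 hcyc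
  have hNfin : (Subgroup.zpowers c).FiniteIndex := hcN ▸ inferInstance
  have hnorm : (Subgroup.zpowers c).Normal := hcN ▸ inferInstance
  have hc : ¬ IsOfFinOrder c := by
    intro h
    have h1 : Finite (Subgroup.zpowers c) := Set.finite_coe_iff.2 (finite_zpowers.2 h)
    exact not_finite_iff_infinite.2 ‹_› ((Subgroup.zpowers c).finite_iff_finite_and_finiteIndex.2
      ⟨h1, hNfin⟩)
  by_contra! hcon
  refine hI (isTypeI_of_central hc hNfin fun g => ?_)
  obtain ⟨k, hk⟩ := Subgroup.mem_zpowers_iff.1 (hnorm.conj_mem c (Subgroup.mem_zpowers c) g)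
  obtain ⟨l, hl⟩ := Subgroup.mem_zpowers_iff.1 (hnorm.conj_mem c (Subgroup.mem_zpowers c) g⁻¹)
  -- Conjugating by `g⁻¹` and then by `g` is trivial, so `k` is a unit of `ℤ`.
  have hkl : c ^ (k * l) = c ^ (1 : ℤ) := by
    rw [mul_comm, zpow_mul, hl, conj_zpow, hk]
    group
  have h1 := injective_zpow_iff_not_isOfFinOrder.2 hc hkl
  rcases Int.eq_one_or_neg_one_of_mul_eq_one h1 with rfl | rfl
  · rw [← hk, zpow_one]
  · exact absurd (by rw [← hk, zpow_neg_one]) (hcon c g hc)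

theorem not_isTypeI_of_conj_eq_inv (hV : IsVirtuallyCyclic V) {c g : V} (hc : ¬ IsOfFinOrder c)
    (h : g * c * g⁻¹ = c⁻¹) : ¬ IsTypeI V := by
  rintro ⟨f, hf⟩
  have := finite_ker hV f hf
  have h1 : f c = (f c)⁻¹ := by
    rw [← map_inv, ← h, map_mul, map_mul, map_inv, mul_comm (f g), mul_inv_cancel_right]
  have h2 : f c = 1 := self_eq_inv.1 h1
  exact hc (f.ker.subtype.isOfFinOrder (isOfFinOrder_of_finite (⟨c, h2⟩ : f.ker)))

/-- Two elements of infinite order in a virtually cyclic group have a common nontrivial power. -/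
theorem IsVirtuallyCyclic.exists_pow_eq_zpow (hV : IsVirtuallyCyclic V) {x y : V}
    (hx : ¬ IsOfFinOrder x) (hy : ¬ IsOfFinOrder y) :
    ∃ (n : ℕ) (m : ℤ), 0 < n ∧ m ≠ 0 ∧ x ^ n = y ^ m := by
  obtain ⟨C, hC, hfin⟩ := hV
  obtain ⟨c, rfl⟩ := (Subgroup.isCyclic_iff_exists_zpowers_eq_top C).1 hC
  have key : ∀ {z : V}, ¬ IsOfFinOrder z → ∃ (i : ℕ) (p : ℤ), 0 < i ∧ p ≠ 0 ∧ c ^ p = z ^ i := by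
    intro z hz
    obtain ⟨i, hi, -, p, hp⟩ := Subgroup.exists_pow_mem_of_index_ne_zero hfin.index_ne_zero z
    refine ⟨i, p, hi, ?_, hp⟩
    rintro rfl
    exact hz (isOfFinOrder_iff_pow_eq_one.2 ⟨i, hi, by simpa using hp.symm⟩)
  obtain ⟨i, p, hi, hp, hx'⟩ := key hx
  obtain ⟨j, q, hj, hq, hy'⟩ := key hy
  -- Both sides equal `c ^ (p * |q|)`; the sign of `q` is moved to the exponent of `y` to keep that
  -- of `x` positive.
  refine ⟨i * q.natAbs, j * (p * q.sign), by positivity, ?_, ?_⟩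
  · simp [hj.ne', hp, hq]
  · rw [pow_mul, ← hx', zpow_mul, zpow_natCast, ← hy', ← zpow_natCast, ← zpow_mul, ← zpow_mul]
    congr 1
    rw [← Int.sign_mul_self_eq_natAbs]
    ring

theorem isInfVCycTypeI_zpowers {c : V} (hc : ¬ IsOfFinOrder c) :
    IsInfVCycTypeI (Subgroup.zpowers c) := by
  have := infinite_zpowers_of_not_isOfFinOrder hc
  let e := (intEquivOfZPowersEqTop _ (zpowers_mk_self_eq_top c)).symm
  exact ⟨this, ⟨⊤, isCyclic_of_injective _ (Subgroup.subtype_injective _), inferInstance⟩,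
    e.toMonoidHom, e.surjective⟩

theorem IsInfVCycTypeI.exists_zpowers_mk_eq_top (hV : IsInfVCycTypeI V) :
    ∃ x : V, Subgroup.zpowers (x : radQuotient V) = ⊤ := by
  obtain ⟨f, hf⟩ := hV.typeI
  obtain ⟨x, hx⟩ := hf (Multiplicative.ofAdd 1)
  have hker : f.ker ≤ finiteRadical V :=
    le_sSup ⟨inferInstance, finite_ker hV.virtuallyCyclic f hf⟩
  refine ⟨x, (Subgroup.eq_top_iff' _).2 fun y => ?_⟩
  obtain ⟨y, rfl⟩ := QuotientGroup.mk_surjective y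
  refine ⟨(f y).toAdd, ?_⟩
  refine QuotientGroup.eq.2 (hker ?_)
  rw [MonoidHom.mem_ker, map_mul, map_inv, map_zpow, hx, ← ofAdd_zsmul]
  simp

theorem IsInfVCycTypeI.not_isOfFinOrder_of_zpowers_eq_top (hV : IsInfVCycTypeI V)
    {σ : radQuotient V} (hσ : Subgroup.zpowers σ = ⊤) : ¬ IsOfFinOrder σ := by
  obtain ⟨f, hf⟩ := hV.typeI
  intro h
  let F : radQuotient V →* Multiplicative ℤ :=
    QuotientGroup.lift (finiteRadical V) f (finiteRadical_le_ker f)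
  have h1 : F σ = 1 := (isOfFinOrder_iff_eq_one _).1 (F.isOfFinOrder h)
  obtain ⟨x, hx⟩ := hf (Multiplicative.ofAdd 1)
  obtain ⟨k, hk⟩ := Subgroup.mem_zpowers_iff.1 (hσ ▸ Subgroup.mem_top (x : radQuotient V))
  have h2 : F (x : radQuotient V) = 1 := by rw [← hk, map_zpow, h1, one_zpow]
  have h3 : f x = 1 := h2
  rw [hx] at h3
  exact absurd h3 (by decide)

end VirtuallyCyclic

/-! ### Elements conjugate to their inverses -/

section Inverted

variable {G : Type u} [Group G]

theorem TypeIOrientable.conj_ne_inv (hG : TypeIOrientable G) {c : G} (hc : ¬ IsOfFinOrder c)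
    (g : G) : g * c * g⁻¹ ≠ c⁻¹ := by
  intro h
  obtain ⟨σ, hσ⟩ := hG
  let W : {V : Subgroup G // IsInfVCycTypeI V} := ⟨Subgroup.zpowers c, isInfVCycTypeI_zpowers hc⟩
  have hx : ∀ x : W.1, ((x⁻¹ : W.1) : G) = g * x * g⁻¹ := by
    rintro ⟨_, k, rfl⟩
    simp [← conj_zpow, h]
  let f : W.1 →* W.1 :=
    { toFun := fun x => x⁻¹
      map_one' := inv_one
      map_mul' := fun x y => Subtype.ext (by simp only [Subgroup.coe_mul, hx]; group) }
  obtain ⟨n, hn, hfn⟩ := hσ.compatible W W f (Or.inr ⟨g, hx⟩)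
  have h1 : ∀ τ : radQuotient W.1, radMap W.2 f τ = τ⁻¹ := fun τ =>
    QuotientGroup.induction_on τ fun _ => rfl
  rw [h1] at hfn
  refine W.2.not_isOfFinOrder_of_zpowers_eq_top (hσ.generator W)
    (isOfFinOrder_iff_pow_eq_one.2 ⟨n + 1, n.succ_pos, ?_⟩)
  rw [pow_succ, ← hfn, inv_mul_cancel]

theorem exists_conj_eq_inv_of_injective {f : KleinBottleGroup →* G} (hf : Function.Injective f) :
    ∃ c g : G, ¬ IsOfFinOrder c ∧ g * c * g⁻¹ = c⁻¹ := by
  refine ⟨f (SemidirectProduct.inl (Multiplicative.ofAdd 1)),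
    f (SemidirectProduct.inr (Multiplicative.ofAdd 1)), ?_, ?_⟩
  · intro h
    have h1 := ((hf.comp SemidirectProduct.inl_injective).isOfFinOrder_iff
      (f := f.comp SemidirectProduct.inl)).1 h
    exact absurd ((isOfFinOrder_iff_eq_one _).1 h1) (by decide)
  · have h1 := SemidirectProduct.inl_aut
      (φ := zpowersHom (MulAut (Multiplicative ℤ)) (MulEquiv.inv (Multiplicative ℤ)))
      (Multiplicative.ofAdd 1) (Multiplicative.ofAdd 1)
    simpa using (congrArg f h1).symm

/-- The right side is phrased through the semidirect action to match the compatibility condition of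
`SemidirectProduct.lift`. -/
theorem zpow_conj_eq_of_conj_eq_inv {c g : G} (h : g * c * g⁻¹ = c⁻¹) (j i : ℤ) :
    g ^ j * c ^ i * (g ^ j)⁻¹ =
      zpowersHom G c (zpowersHom (MulAut (Multiplicative ℤ)) (MulEquiv.inv (Multiplicative ℤ))
        (Multiplicative.ofAdd j) (Multiplicative.ofAdd i)) := by
  have h1 : ∀ i : ℤ, g * c ^ i * g⁻¹ = c ^ (-i) := fun i => by
    rw [← conj_zpow, h, inv_zpow, zpow_neg]
  have h2 : ∀ i : ℤ, g⁻¹ * c ^ i * g = c ^ (-i) := fun i => by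
    rw [← neg_neg i, ← h1, neg_neg]
    group
  simp only [zpowersHom_apply, toAdd_ofAdd]
  induction j generalizing i with
  | zero => simp
  | succ j ih =>
    have h3 := ih (-i)
    rw [← h1] at h3
    rw [zpow_add_one, zpow_add_one, MulAut.mul_apply]
    refine Eq.trans ?_ (h3.trans rfl)
    group
  | pred j ih =>
    have h3 := ih (-i)
    rw [← h2] at h3
    rw [zpow_sub_one, zpow_sub_one, MulAut.mul_apply]
    refine Eq.trans ?_ (h3.trans rfl)
    group

/-- The homomorphism from the Klein bottle group determined by `g * c * g⁻¹ = c⁻¹`. -/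
def kleinBottleLift {c g : G} (h : g * c * g⁻¹ = c⁻¹) : KleinBottleGroup →* G :=
  SemidirectProduct.lift (zpowersHom G c) (zpowersHom G g) fun j => MonoidHom.ext fun i =>
    (zpow_conj_eq_of_conj_eq_inv h j.toAdd i.toAdd).symm

theorem kleinBottleLift_apply {c g : G} (h : g * c * g⁻¹ = c⁻¹) (x : KleinBottleGroup) :
    kleinBottleLift h x = c ^ x.left.toAdd * g ^ x.right.toAdd := rfl

theorem conj_ne_inv_of_isTypeI
    (hI : ∀ V : Subgroup G, Infinite V → IsVirtuallyCyclic V → IsTypeI V)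
    (hK : ¬ ∃ f : KleinBottleGroup →* G, Function.Injective f) {c : G} (hc : ¬ IsOfFinOrder c)
    (g : G) : g * c * g⁻¹ ≠ c⁻¹ := by
  intro h
  have hF : ¬ Function.Injective (kleinBottleLift h) := fun hF => hK ⟨_, hF⟩
  rw [← MonoidHom.ker_eq_bot_iff, Subgroup.eq_bot_iff_forall] at hF
  push Not at hF
  obtain ⟨x, hx, hx1⟩ := hF
  rw [MonoidHom.mem_ker, kleinBottleLift_apply] at hx
  -- A kernel element lying in the left factor would be a relation on `c` alone; hence a nonzero
  -- power of `g` lies in `⟨c⟩`.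
  have hr : x.right.toAdd ≠ 0 := by
    intro h0
    rw [h0, zpow_zero, mul_one] at hx
    have h1 : x.left.toAdd = 0 := by
      by_contra hne
      exact hc (isOfFinOrder_iff_zpow_eq_one.2 ⟨_, hne, hx⟩)
    exact hx1 (SemidirectProduct.ext h1 h0)
  have hgk : g ^ x.right.toAdd ∈ Subgroup.zpowers c := by
    rw [← inv_eq_of_mul_eq_one_right hx]
    exact inv_mem (zpow_mem (Subgroup.mem_zpowers c) _)
  set V := (kleinBottleLift h).range
  let a : V := ⟨c, SemidirectProduct.inl (Multiplicative.ofAdd 1), by simp [kleinBottleLift_apply]⟩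
  let b : V := ⟨g, SemidirectProduct.inr (Multiplicative.ofAdd 1), by simp [kleinBottleLift_apply]⟩
  have ha : ¬ IsOfFinOrder a := fun ha => hc (V.subtype.isOfFinOrder ha)
  have hba : b * a * b⁻¹ = a⁻¹ := Subtype.ext h
  -- The power of `a` stands on the right so that left cosets of `⟨a⟩` absorb it; reducing `j`
  -- modulo `x.right.toAdd` then leaves finitely many cosets.
  have hgen : ∀ v : V, ∃ i j : ℤ, v = b ^ j * a ^ i := by
    rintro ⟨_, y, rfl⟩
    obtain ⟨s, hs⟩ : ∃ s : ℤ, (g ^ y.right.toAdd)⁻¹ * c ^ y.left.toAdd * g ^ y.right.toAdd = c ^ s :=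
      ⟨_, by simpa using zpow_conj_eq_of_conj_eq_inv h (-y.right.toAdd) y.left.toAdd⟩
    refine ⟨s, y.right.toAdd, Subtype.ext ?_⟩
    change c ^ y.left.toAdd * g ^ y.right.toAdd = g ^ y.right.toAdd * c ^ s
    rw [← hs]
    group
  have hV : IsVirtuallyCyclic V := by
    refine ⟨Subgroup.zpowers a, inferInstance, ?_⟩
    have hbk : b ^ x.right.toAdd ∈ Subgroup.zpowers a := by
      obtain ⟨l, hl⟩ := hgk
      exact ⟨l, Subtype.ext hl⟩
    have : Finite (V ⧸ Subgroup.zpowers a) := by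
      refine Finite.of_surjective (fun r : Set.Ico (0 : ℤ) |x.right.toAdd| =>
        ((b ^ (r : ℤ) : V) : V ⧸ Subgroup.zpowers a)) fun q => ?_
      obtain ⟨v, rfl⟩ := QuotientGroup.mk_surjective q
      obtain ⟨i, j, rfl⟩ := hgen v
      refine ⟨⟨j % x.right.toAdd, Int.emod_nonneg _ hr, Int.emod_lt_abs _ hr⟩, ?_⟩
      refine QuotientGroup.eq.2 ?_
      have hj : (b ^ (j % x.right.toAdd))⁻¹ * (b ^ j * a ^ i) =
          (b ^ x.right.toAdd) ^ (j / x.right.toAdd) * a ^ i := by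
        rw [← mul_assoc, ← zpow_neg, ← zpow_add, ← zpow_mul, Int.emod_def]
        congr 2
        ring
      rw [hj]
      exact mul_mem (zpow_mem hbk _) (zpow_mem (Subgroup.mem_zpowers a) _)
    exact Subgroup.finiteIndex_of_finite_quotient
  have := infinite_zpowers_of_not_isOfFinOrder ha
  have hinf : Infinite V := Infinite.of_injective _ (Subgroup.subtype_injective (Subgroup.zpowers a))
  exact not_isTypeI_of_conj_eq_inv hV ha hba (hI V hinf hV)

end Inverted

end CatZeroOrient

namespace CatZeroOrient

/-! ### Positive elements -/

section Positive

variable {G : Type u} [Group G]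

/-- Some positive powers of `a` and `b` are conjugate in `G`. -/
def PosCommensurable (a b : G) : Prop :=
  ∃ (g : G) (m n : ℕ), 0 < m ∧ 0 < n ∧ g * a ^ m * g⁻¹ = b ^ n

theorem PosCommensurable.refl (a : G) : PosCommensurable a a :=
  ⟨1, 1, 1, one_pos, one_pos, by simp⟩

theorem PosCommensurable.symm {a b : G} (h : PosCommensurable a b) : PosCommensurable b a := by
  obtain ⟨g, m, n, hm, hn, h⟩ := h
  exact ⟨g⁻¹, n, m, hn, hm, by rw [← h]; group⟩

theorem PosCommensurable.trans {a b c : G} (h₁ : PosCommensurable a b)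
    (h₂ : PosCommensurable b c) : PosCommensurable a c := by
  obtain ⟨g, m, n, hm, hn, h⟩ := h₁
  obtain ⟨k, p, q, hp, hq, h'⟩ := h₂
  refine ⟨k * g, m * p, q * n, by positivity, by positivity, ?_⟩
  have h1 : g * a ^ (m * p) * g⁻¹ = (b ^ p) ^ n := by
    rw [pow_mul, ← conj_pow, h, ← pow_mul, ← pow_mul, mul_comm]
  calc k * g * a ^ (m * p) * (k * g)⁻¹ = k * (g * a ^ (m * p) * g⁻¹) * k⁻¹ := by group
    _ = c ^ (q * n) := by rw [h1, ← conj_pow, h', pow_mul]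

theorem PosCommensurable.inv {a b : G} (h : PosCommensurable a b) : PosCommensurable a⁻¹ b⁻¹ := by
  obtain ⟨g, m, n, hm, hn, h⟩ := h
  exact ⟨g, m, n, hm, hn, by rw [inv_pow, inv_pow, ← h]; group⟩

theorem IsCATZeroGroup.not_posCommensurable_inv (hG : IsCATZeroGroup.{u, v} G)
    (h : ∀ c : G, ¬ IsOfFinOrder c → ∀ g : G, g * c * g⁻¹ ≠ c⁻¹) {a : G}
    (ha : ¬ IsOfFinOrder a) : ¬ PosCommensurable a a⁻¹ := by
  rintro ⟨g, m, n, hm, hn, hg⟩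
  have h1 := hG.abs_eq_of_conj_zpow_eq ha (m := m) (n := -n) (g := g)
    (by rw [zpow_natCast, hg, zpow_neg, zpow_natCast, inv_pow])
  rw [abs_neg, Nat.abs_cast, Nat.abs_cast, Nat.cast_inj] at h1
  subst h1
  exact h (a ^ m) (fun hf => ha (hf.of_pow hm.ne')) g (by rw [hg, inv_pow])

/-- `a` and `b` are commensurable up to conjugation and inversion. -/
def commensurableSetoid (G : Type u) [Group G] : Setoid G where
  r a b := PosCommensurable a b ∨ PosCommensurable a b⁻¹
  iseqv :=
    { refl := fun a => Or.inl (.refl a)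
      symm := by
        rintro a b (h | h)
        · exact Or.inl h.symm
        · exact Or.inr (by simpa using h.symm.inv)
      trans := by
        rintro a b c (h | h) (h' | h')
        · exact Or.inl (h.trans h')
        · exact Or.inr (h.trans h')
        · exact Or.inr (h.trans h'.inv)
        · exact Or.inl (h.trans (by simpa using h'.inv)) }

/-! ### Choice of signs and construction of the orientation -/

/-- Each class up to inversion gets a representative, and the elements positively commensurable to
it count as positive. Since `a` and `a⁻¹` share a representative, both being positive would make
them commensurable. -/
theorem exists_positive (h : ∀ a : G, ¬ IsOfFinOrder a → ¬ PosCommensurable a a⁻¹) :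
    ∃ P : G → Prop, (∀ a b, PosCommensurable a b → P a → P b) ∧ (∀ a, P a ∨ P a⁻¹) ∧
      ∀ a, ¬ IsOfFinOrder a → P a → ¬ P a⁻¹ := by
  let rep : G → G := fun a => (Quotient.mk (commensurableSetoid G) a).out
  have hrep : ∀ {a b : G}, (PosCommensurable a b ∨ PosCommensurable a b⁻¹) → rep a = rep b :=
    fun hab => congrArg Quotient.out (Quotient.sound (s := commensurableSetoid G) hab)
  have hinv : ∀ a : G, rep a⁻¹ = rep a := fun a => hrep (Or.inr (.refl _))
  refine ⟨fun a => PosCommensurable (rep a) a, fun a b hab ha => ?_, fun a => ?_,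
    fun a hfin ha ha' => ?_⟩
  · change PosCommensurable (rep b) b
    rw [← hrep (Or.inl hab)]
    exact PosCommensurable.trans ha hab
  · change PosCommensurable (rep a) a ∨ PosCommensurable (rep a⁻¹) a⁻¹
    rw [hinv]
    exact Quotient.mk_out (s := commensurableSetoid G) a
  · change PosCommensurable (rep a⁻¹) a⁻¹ at ha'
    rw [hinv] at ha'
    exact h a hfin (PosCommensurable.trans (PosCommensurable.symm ha) ha')

theorem typeIOrientable_of_not_posCommensurable_inv
    (h : ∀ a : G, ¬ IsOfFinOrder a → ¬ PosCommensurable a a⁻¹) : TypeIOrientable G := by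
  obtain ⟨P, hP, hP_or, hP_not⟩ := exists_positive h
  have hx : ∀ V : {V : Subgroup G // IsInfVCycTypeI V}, ∃ x : V.1,
      Subgroup.zpowers (x : radQuotient V.1) = ⊤ ∧ P x := by
    intro V
    obtain ⟨x, hx⟩ := V.2.exists_zpowers_mk_eq_top
    rcases hP_or x with h1 | h1
    · exact ⟨x, hx, h1⟩
    · exact ⟨x⁻¹, by rw [QuotientGroup.mk_inv, Subgroup.zpowers_inv, hx], h1⟩
  choose x hgen hpos using hx
  have hgen_inf : ∀ V, ¬ IsOfFinOrder (x V : radQuotient V.1) := fun V =>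
    V.2.not_isOfFinOrder_of_zpowers_eq_top (hgen V)
  have hinf : ∀ V, ¬ IsOfFinOrder (x V) := fun V hV =>
    hgen_inf V ((QuotientGroup.mk' _).isOfFinOrder hV)
  refine ⟨fun V => x V, hgen, fun V W f hf => ?_⟩
  have hcoe : ∃ g : G, ∀ y : V.1, (f y : G) = g * y * g⁻¹ := by
    rcases hf with hf | hf
    · exact ⟨1, fun y => by simp [hf]⟩
    · exact hf
  obtain ⟨g, hg⟩ := hcoe
  have hfx : ¬ IsOfFinOrder (f (x V)) := by
    have hf_inj : Function.Injective f := fun y z hyz => by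
      have := congrArg Subtype.val hyz
      rw [hg, hg] at this
      exact Subtype.ext (by simpa using this)
    rw [hf_inj.isOfFinOrder_iff]
    exact hinf V
  have hPfx : P (f (x V)) := hP _ _ ⟨g, 1, 1, one_pos, one_pos, by simp [hg]⟩ (hpos V)
  obtain ⟨n, m, hn, hm, hnm⟩ := W.2.virtuallyCyclic.exists_pow_eq_zpow hfx (hinf W)
  have hnm' : (f (x V) : G) ^ n = (x W : G) ^ m := congrArg Subtype.val hnm
  -- For `m < 0` the inverse of `x W` would be commensurable to the positive element `f (x V)`,
  -- although `x W` is positive.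
  have hm_pos : 0 < m := by
    rcases hm.lt_or_gt with hlt | hgt
    · refine absurd (hP _ _ ⟨1, n, m.natAbs, hn, Int.natAbs_pos.2 hm, ?_⟩ hPfx)
        (hP_not _ (fun hW => hinf W (W.1.subtype_injective.isOfFinOrder_iff.1 hW)) (hpos W))
      rw [one_mul, inv_one, mul_one, hnm', ← zpow_natCast, Int.ofNat_natAbs_of_nonpos hlt.le,
        inv_zpow, zpow_neg, inv_inv, Subgroup.subtype_apply]
    · exact hgt
  obtain ⟨k, hk⟩ := Subgroup.mem_zpowers_iff.1
    (hgen W ▸ Subgroup.mem_top (f (x V) : radQuotient W.1))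
  have hkn : (x W : radQuotient W.1) ^ (k * n) = (x W : radQuotient W.1) ^ m := by
    rw [zpow_mul, hk, zpow_natCast]
    exact congrArg (QuotientGroup.mk' (finiteRadical W.1)) hnm
  -- The exponent `k` of the induced map thus inherits its sign from `m`.
  have hkn' : k * n = m := injective_zpow_iff_not_isOfFinOrder.2 (hgen_inf W) hkn
  have hk_pos : 0 < k := pos_of_mul_pos_left (hkn' ▸ hm_pos) n.cast_nonneg
  lift k to ℕ using hk_pos.le
  exact ⟨k, by exact_mod_cast hk_pos, by rw [← zpow_natCast, hk]; rfl⟩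

end Positive

end CatZeroOrient

theorem mainTheorem6 (G : Type u) [Group G] (hG : CatZeroOrient.IsCATZeroGroup.{u, v} G) :
    CatZeroOrient.TypeIOrientable G ↔
      (∀ V : Subgroup G, Infinite V → CatZeroOrient.IsVirtuallyCyclic V →
        CatZeroOrient.IsTypeI V) ∧
      ¬ ∃ f : CatZeroOrient.KleinBottleGroup →* G, Function.Injective f := by
  refine ⟨fun h => ⟨fun V _ hV => ?_, ?_⟩, fun h => ?_⟩
  · by_contra hI
    obtain ⟨c, g, hc, hcg⟩ := CatZeroOrient.exists_conj_eq_inv_of_not_isTypeI hV hI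
    exact h.conj_ne_inv (fun hfin => hc (V.subtype_injective.isOfFinOrder_iff.1 hfin)) g
      (congrArg Subtype.val hcg)
  · rintro ⟨f, hf⟩
    obtain ⟨c, g, hc, hcg⟩ := CatZeroOrient.exists_conj_eq_inv_of_injective hf
    exact h.conj_ne_inv hc g hcg
  · exact CatZeroOrient.typeIOrientable_of_not_posCommensurable_inv fun a =>
      hG.not_posCommensurable_inv fun c hc => CatZeroOrient.conj_ne_inv_of_isTypeI h.1 h.2 hc
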